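/- Conventions. An alphabet is a nonempty finite set $A$; $A^+$ is the free semigroup on $A$ (nonempty words) and $A^*$ the free monoid. A map $\psi:A\to S$ into a semigroup $S$ generates $S$ if its extension to a homomorphism $\psi:A^+\to S$ is surjective; $S$ is finitely generated if some alphabet admits such a map. Let $\$\notin A$, $A(2,\$)=((A\cup\{\$\})\times(A\cup\{\$\}))\setminus\{(\$,\$)\}$, and let $\delta_A:A^*\times A^*\to A(2,\$)^*$ be the map which pads the shorter of two words on the right with $\$$ to the length of the longer one and then reads the two words in parallel. The semigroup $S$ is automatic if there are an alphabet $A$, a generating map $\psi:A\to S$ and a regular language $L\subseteq A^+$ with $L\psi=S$ such that the languages $$L_= =\{(\alpha,\beta)\delta_A:\alpha,\beta\in L,\ \alpha\psi=\beta\psi\},\qquad L_a=\{(\alpha,\beta)\delta_A:\alpha,\beta\in L,\ (\alpha\psi)(a\psi)=\beta\psi\}\quad(a\in A)$$ are regular. The diagonal $S$-act is the set $S\times S$ with the right action $(s_1,s_2)s=(s_1s,s_2s)$; it is finitely generated if there is a finite $U\subseteq S\times S$ such that $S\times S=U\cup US$. The unrestricted wreath product of semigroups $S$ and $T$ is the set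 $S^T\times T$ of pairs of a map $f:T\to S$ and an element of $T$, with multiplication $(f,t)(g,u)=(f\,{}^t g,\,tu)$, where $({}^t g)(x)=g(xt)$ and the product in $S^T$ is pointwise. Let $e$ be a distinguished idempotent, either of $S$ or equal to an identity adjoined to $S$ (which is always available, even if $S$ has no idempotent). The wreath product $S\wr T$ is the subsemigroup of the unrestricted wreath product generated by the pairs $(f,t)$ such that $\{x\in T: f(x)\neq e\}$ is finite; if $T$ is finite, it is all of $S^T\times T$, for every $e$. Theorem. Let $S$ and $T$ be semigroups such that (i) $T$ is finite; (ii) $S$ is automatic; (iii) the diagonal $S$-act is not finitely generated; (iv) the wreath product $S\wr T$ is finitely generated. Then $S\wr T$ is automatic. -/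

import Mathlib

/-! ### Words and finite generating sets

The free semigroup `A⁺` is `FreeSemigroup A`, the free monoid `A*` is `List A`, and the extension
of `ψ : A → S` to a homomorphism `A⁺ → S` is `FreeSemigroup.lift ψ`. -/

/-- The finite sequence of letters of an element of the free semigroup `A⁺`. -/
def FreeSemigroup.letters {A : Type*} (w : FreeSemigroup A) : List A :=
  w.head :: w.tail

/-- `A` generates the semigroup `S` with respect to `ψ : A → S`: the homomorphism `A⁺ → S`
extending `ψ` is surjective. -/
def IsGeneratingMap {A S : Type*} [Semigroup S] (ψ : A → S) : Prop :=
  Function.Surjective (FreeSemigroup.lift ψ)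

/-- A semigroup is finitely generated if some (nonempty, finite) alphabet generates it. -/
def IsFinitelyGeneratedSemigroup (S : Type*) [Semigroup S] : Prop :=
  ∃ (A : Type) (_ : Nonempty A) (_ : Finite A) (ψ : A → S), IsGeneratingMap ψ

/-! ### Automatic semigroups -/

/-- The padded alphabet `A(2,$) = ((A ∪ {$}) × (A ∪ {$})) \ {($,$)}`; the padding symbol `$` is
`none`. -/
abbrev PaddedPair (A : Type*) : Type _ :=
  {p : Option A × Option A // p ≠ (none, none)}

/-- The padding map `δ_A : A* × A* → A(2,$)*`, written with two arguments. -/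
def padPair {A : Type*} : List A → List A → List (PaddedPair A)
  | [], v => v.map fun b => ⟨(none, some b), by simp⟩
  | a :: u, [] => ⟨(some a, none), by simp⟩ :: padPair u []
  | a :: u, b :: v => ⟨(some a, some b), by simp⟩ :: padPair u v

/-- The set of nonempty words `L ⊆ A⁺`, seen as a language over `A`. -/
def wordLanguage {A : Type*} (L : Set (FreeSemigroup A)) : Language A :=
  FreeSemigroup.letters '' L

/-- The image under `δ_A` of a binary relation on `A⁺`, as a language over `A(2,$)`. -/
def paddedLanguage {A : Type*} (R : Set (FreeSemigroup A × FreeSemigroup A)) :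
    Language (PaddedPair A) :=
  (fun p : FreeSemigroup A × FreeSemigroup A => padPair p.1.letters p.2.letters) '' R

/-- `(A, L)` is an automatic structure for the semigroup `S` with respect to `ψ : A → S`. -/
structure IsAutomaticStructure {A S : Type*} [Semigroup S] (ψ : A → S)
    (L : Set (FreeSemigroup A)) : Prop where
  generates : IsGeneratingMap ψ
  regular : (wordLanguage L).IsRegular
  image_eq : FreeSemigroup.lift ψ '' L = Set.univ
  regular_eq : (paddedLanguage
    {p | p.1 ∈ L ∧ p.2 ∈ L ∧ FreeSemigroup.lift ψ p.1 = FreeSemigroup.lift ψ p.2}).IsRegular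
  regular_mul : ∀ a : A, (paddedLanguage
    {p | p.1 ∈ L ∧ p.2 ∈ L ∧
      FreeSemigroup.lift ψ p.1 * ψ a = FreeSemigroup.lift ψ p.2}).IsRegular

/-- A semigroup is automatic if it has an automatic structure over some (nonempty, finite)
alphabet. -/
def IsAutomaticSemigroup (S : Type*) [Semigroup S] : Prop :=
  ∃ (A : Type) (_ : Nonempty A) (_ : Finite A) (ψ : A → S) (L : Set (FreeSemigroup A)),
    IsAutomaticStructure ψ L

/-! ### Acts of semigroups -/

/-- A (right) action of a semigroup `S` on a set `X`. -/
structure SemigroupAct (S X : Type*) [Semigroup S] where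
  /-- the action `(x, s) ↦ x s` -/
  act : X → S → X
  act_act : ∀ x s₁ s₂, act (act x s₁) s₂ = act x (s₁ * s₂)

/-- The act is finitely generated: `U S¹ = X` for some finite `U ⊆ X`. -/
def SemigroupAct.IsFinitelyGenerated {S X : Type*} [Semigroup S] (α : SemigroupAct S X) : Prop :=
  ∃ U : Set X, U.Finite ∧ ∀ x : X, x ∈ U ∨ ∃ u ∈ U, ∃ s : S, x = α.act u s

/-- The diagonal act of `S`: the set `S × S` with `(s₁, s₂) s = (s₁ s, s₂ s)`. -/
def diagonalAct (S : Type*) [Semigroup S] : SemigroupAct S (S × S) where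
  act p s := (p.1 * s, p.2 * s)
  act_act p s₁ s₂ := by simp [mul_assoc]

/-! ### Wreath products -/

/-- The unrestricted wreath product of `S` and `T`: the set `S^T × T`. -/
@[ext]
structure UnrestrictedWreath (S T : Type*) where
  /-- the component in `S^T` -/
  base : T → S
  /-- the component in `T` -/
  top : T

/-- The multiplication `(f, t)(g, u) = (f ᵗg, t u)`, where `(x) ᵗg = (x t) g`. -/
instance UnrestrictedWreath.instSemigroup (S T : Type*) [Semigroup S] [Semigroup T] :
    Semigroup (UnrestrictedWreath S T) where
  mul p q := ⟨fun x => p.base x * q.base (x * p.top), p.top * q.top⟩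
  mul_assoc p q r := UnrestrictedWreath.ext
    (funext fun x => by
      change p.base x * q.base (x * p.top) * r.base (x * (p.top * q.top)) =
        p.base x * (q.base (x * p.top) * r.base (x * p.top * q.top))
      rw [mul_assoc, mul_assoc x])
    (mul_assoc p.top q.top r.top)

/-- The support of `f ∈ S^X` relative to `e`, where `e` is an element of `S` or the identity
adjoined to `S`. -/
def relSupport {S X : Type*} (e : WithOne S) (f : X → S) : Set X :=
  {x | (f x : WithOne S) ≠ e}

/-- The (restricted) wreath product of `S` and `T` with respect to the distinguished idempotent
`e`, which is an idempotent of `S` or (in particular when `S` has no idempotent) the identity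
adjoined to `S`: the subsemigroup of the unrestricted wreath product generated by the pairs
`(f, t)` with `f` of finite support relative to `e`. -/
def wreathProduct (S T : Type*) [Semigroup S] [Semigroup T] (e : WithOne S) :
    Subsemigroup (UnrestrictedWreath S T) :=
  Subsemigroup.closure {p | (relSupport e p.base).Finite}

/-- For finite `T` the restricted wreath product is the unrestricted one, whatever `e` is. -/
theorem wreathProduct_eq_top (S T : Type*) [Semigroup S] [Semigroup T] [Finite T]
    (e : WithOne S) : wreathProduct S T e = ⊤ :=
  top_unique fun _ _ => Subsemigroup.subset_closure (Set.toFinite _)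

/-! For finite `T` the restricted wreath product is all of `S^T × T`. If `T` is trivial it is
isomorphic to `S`. Otherwise an element is a tuple of elements of `S` indexed by `T`, together with
an element of `T`, and the plan is to read representatives of all coordinates in parallel. There are
two obstacles: the coordinate words have different lengths, and the `T`-components of letters shift
the coordinates.

Lengths. The diagonal act is not finitely generated, so `S` is infinite, and then finite generation
of the wreath product forces `S = S²` (`eq_mul_of_isFinitelyGenerated`). Factoring last letters
repeatedly and using the pigeonhole principle, every generator of `S` has the form `p z` with `z = q
z` (`exists_eq_mul_and_mul_eq`). The last letter of a word may thus be replaced by `p qᵏ z`, which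
stretches the word to any greater length without changing its value.

Shifts. If some `t` had no left divisor (possibly `t` itself) acting injectively on `T` from the
right, a left divisor with minimal kernel would identify two coordinates, and finitely many
generators of the wreath product would generate the diagonal act (`exists_injective_mul_right`).
Hence every `t` is `r u` with `r` a right identity (`exists_rightIdentity_mul`). Letters with
`T`-component `r` shift nothing, and only the last letter carries `u`.

For tuples of stretched words of equal length, equality and multiplication by a fixed element then
become finite unions, over the `T`-component of the left word, of coordinatewise conditions. Each
condition is recognized by the automatic structure of `S`; erasing the added tails keeps the
remaining letters in position, so synchronous reading survives. -/

/-! ### Closure properties of regular languages -/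

namespace Language

variable {α β : Type}

theorem isRegular_foldl {σ : Type*} [Finite σ] (step : σ → α → σ) (s : σ) (F : Set σ) :
    IsRegular ({l | l.foldl step s ∈ F} : Language α) := by
  have := Fintype.ofFinite σ
  exact isRegular_iff.2 ⟨σ, inferInstance, ⟨step, s, F⟩, rfl⟩

theorem IsRegular.exists_foldl {L : Language α} (h : L.IsRegular) :
    ∃ (σ : Type) (_ : Finite σ) (step : σ → α → σ) (s : σ) (F : Set σ),
      ∀ l, l ∈ L ↔ l.foldl step s ∈ F := by
  obtain ⟨σ, _, M, rfl⟩ := h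
  exact ⟨σ, inferInstance, M.step, M.start, M.accept, fun _ => Iff.rfl⟩

theorem IsRegular.congr {L L' : Language α} (h : L.IsRegular) (e : ∀ l, l ∈ L' ↔ l ∈ L) :
    L'.IsRegular := by
  rwa [show L' = L from Set.ext e]

theorem IsRegular.preimage_filterMap {L : Language β} (h : L.IsRegular) (f : α → Option β) :
    IsRegular ({l | l.filterMap f ∈ L} : Language α) := by
  obtain ⟨σ, _, step, s, F, hL⟩ := h.exists_foldl
  refine (isRegular_foldl (fun s a => (f a).elim s (step s)) s F).congr fun l => ?_
  change l.filterMap f ∈ L ↔ l.foldl _ s ∈ F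
  rw [hL]
  suffices ∀ s, (l.filterMap f).foldl step s =
      l.foldl (fun s a => (f a).elim s (step s)) s by rw [this]
  induction l with
  | nil => simp
  | cons a l ih => intro s; cases hfa : f a <;> simp [hfa, ih]

theorem IsRegular.preimage_map {L : Language β} (h : L.IsRegular) (f : α → β) :
    IsRegular ({l | l.map f ∈ L} : Language α) :=
  (h.preimage_filterMap fun a => some (f a)).congr fun l => by
    change l.map f ∈ L ↔ l.filterMap (fun a => some (f a)) ∈ L
    rw [← List.filterMap_eq_map]; rfl

/-- Subset construction: the automaton tracks all states reachable by reading some preimage of the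
input. -/
theorem IsRegular.image_map {L : Language α} (h : L.IsRegular) (f : α → β) :
    IsRegular ({l | ∃ l' ∈ L, l'.map f = l} : Language β) := by
  obtain ⟨σ, _, step, s, F, hL⟩ := h.exists_foldl
  let stepSet : Set σ → β → Set σ := fun X b => {t | ∃ s ∈ X, ∃ a, f a = b ∧ step s a = t}
  have key : ∀ (l : List β) (X : Set σ) (t : σ), t ∈ l.foldl stepSet X ↔
      ∃ s ∈ X, ∃ l' : List α, l'.map f = l ∧ l'.foldl step s = t := by
    intro l
    induction l with
    | nil => intro X t; simp
    | cons b l ih =>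
      intro X t
      rw [List.foldl_cons, ih]
      constructor
      · rintro ⟨_, ⟨s, hs, a, rfl, rfl⟩, l', rfl, rfl⟩
        exact ⟨s, hs, a :: l', by simp, by simp⟩
      · rintro ⟨s, hs, l', h1, rfl⟩
        obtain ⟨a, l'', rfl, rfl, rfl⟩ := List.map_eq_cons_iff.1 h1
        exact ⟨_, ⟨s, hs, a, rfl, rfl⟩, l'', rfl, by simp⟩
  refine (isRegular_foldl stepSet {s} {X | ∃ t ∈ X, t ∈ F}).congr fun l => ?_
  change (∃ l' ∈ L, l'.map f = l) ↔ ∃ t ∈ l.foldl stepSet {s}, t ∈ F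
  simp only [key, hL, Set.mem_singleton_iff]
  constructor
  · rintro ⟨l', h1, h2⟩
    exact ⟨_, ⟨s, rfl, l', h2, rfl⟩, h1⟩
  · rintro ⟨_, ⟨_, rfl, l', h2, rfl⟩, h1⟩
    exact ⟨l', h1, h2⟩

/-- Only the accepting states change. This absorbs the surplus padding that appears when synchronous
relations are composed. -/
theorem IsRegular.quotient_replicate {L : Language α} (h : L.IsRegular) (a : α) :
    IsRegular ({l | ∃ k, l ++ List.replicate k a ∈ L} : Language α) := by
  obtain ⟨σ, _, step, s, F, hL⟩ := h.exists_foldl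
  refine (isRegular_foldl step s {t | ∃ k, (List.replicate k a).foldl step t ∈ F}).congr
    fun l => ?_
  change (∃ k, l ++ List.replicate k a ∈ L) ↔
    ∃ k, (List.replicate k a).foldl step (l.foldl step s) ∈ F
  simp [hL]

theorem isRegular_univ : IsRegular (Set.univ : Language α) :=
  (isRegular_foldl (fun (_ : Unit) (_ : α) => ()) () Set.univ).congr fun _ => by
    constructor <;> intro <;> trivial

theorem IsRegular.and {L L' : Language α} (h : L.IsRegular) (h' : L'.IsRegular) :
    IsRegular ({l | l ∈ L ∧ l ∈ L'} : Language α) :=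
  h.inf h'

theorem isRegular_forall {ι : Type*} [Finite ι] {L : ι → Language α}
    (h : ∀ i, (L i).IsRegular) : IsRegular ({l | ∀ i, l ∈ L i} : Language α) := by
  classical
  have := Fintype.ofFinite ι
  suffices ∀ s : Finset ι, IsRegular ({l | ∀ i ∈ s, l ∈ L i} : Language α) from
    (this Finset.univ).congr fun l => by
      change (∀ i, l ∈ L i) ↔ ∀ i ∈ Finset.univ, l ∈ L i
      simp
  intro s
  induction s using Finset.induction_on with
  | empty =>
    refine isRegular_univ.congr fun l => ⟨fun _ => trivial, fun _ i hi => ?_⟩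
    simp at hi
  | insert i s _ ih =>
    refine ((h i).and ih).congr fun l => ?_
    change (∀ j ∈ insert i s, l ∈ L j) ↔ l ∈ L i ∧ ∀ j ∈ s, l ∈ L j
    simp

theorem isRegular_exists {ι : Type*} [Finite ι] {L : ι → Language α}
    (h : ∀ i, (L i).IsRegular) : IsRegular ({l | ∃ i, l ∈ L i} : Language α) :=
  (isRegular_forall fun i => (h i).compl).compl.congr fun l => by
    change (∃ i, l ∈ L i) ↔ ¬ ∀ i, ¬ l ∈ L i
    simp

/-- The automaton remembers only the last letter: `none` is the rejecting sink, `some none` the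
initial state, `some (some b)` means that `b` was read last. -/
theorem isRegular_isChain [Finite α] (R : α → α → Prop) (Q : α → Prop) :
    IsRegular ({l | l.IsChain R ∧ ∀ a ∈ l.getLast?, Q a} : Language α) := by
  classical
  let step : Option (Option α) → α → Option (Option α) := fun s a =>
    match s with
    | none => none
    | some none => some (some a)
    | some (some b) => if R b a then some (some a) else none
  let F : Set (Option (Option α)) := {s | ∃ o : Option α, s = some o ∧ ∀ a ∈ o, Q a}
  have hnone : ∀ l : List α, l.foldl step none = none := by
    intro l; induction l with
    | nil => rfl
    | cons a l ih => exact ih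
  have key : ∀ (l : List α) (b : α), l.foldl step (some (some b)) ∈ F ↔
      (b :: l).IsChain R ∧ ∀ a ∈ (b :: l).getLast?, Q a := by
    intro l
    induction l with
    | nil => intro b; simp [F]
    | cons a l ih =>
      intro b
      rw [List.foldl_cons, List.isChain_cons_cons, List.getLast?_cons_cons]
      by_cases hR : R b a
      · rw [show step (some (some b)) a = some (some a) from if_pos hR, ih]; tauto
      · rw [show step (some (some b)) a = none from if_neg hR, hnone]; simp [F, hR]
  refine (isRegular_foldl step (some none) F).congr fun l => ?_
  change (l.IsChain R ∧ ∀ a ∈ l.getLast?, Q a) ↔ l.foldl step (some none) ∈ F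
  cases l with
  | nil => simp [F]
  | cons a l => exact (key l a).symm

/-- The finite semigroup itself is the state set; `none` stands for the empty word, which has no
value. -/
theorem isRegular_lift_eq {T : Type*} [Semigroup T] [Finite T] (φ : α → T) (t : T) :
    IsRegular ({l | ∃ w : FreeSemigroup α, w.letters = l ∧ FreeSemigroup.lift φ w = t} :
      Language α) := by
  let step : Option T → α → Option T := fun s a => some (s.elim (φ a) (· * φ a))
  refine (isRegular_foldl step none {some t}).congr fun l => ?_
  change (∃ w : FreeSemigroup α, w.letters = l ∧ FreeSemigroup.lift φ w = t) ↔
    l.foldl step none = some t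
  cases l with
  | nil => simp [FreeSemigroup.letters]
  | cons a l =>
    have : ∀ s, l.foldl step (some s) = some (l.foldl (· * φ ·) s) := by
      induction l with
      | nil => intro s; rfl
      | cons b l ih => intro s; simp [step, ih]
    rw [List.foldl_cons, show step none a = some (φ a) from rfl, this, Option.some_inj,
      ← FreeSemigroup.lift_mk_eq_foldl]
    constructor
    · rintro ⟨⟨b, m⟩, h, rfl⟩
      simp only [FreeSemigroup.letters, List.cons.injEq] at h
      obtain ⟨rfl, rfl⟩ := h
      rfl
    · intro h
      exact ⟨⟨a, l⟩, rfl, h⟩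

end Language

theorem FreeSemigroup.letters_injective {A : Type*} :
    Function.Injective (FreeSemigroup.letters : FreeSemigroup A → List A) := by
  rintro ⟨a, l⟩ ⟨b, m⟩ h
  simp only [FreeSemigroup.letters, List.cons.injEq] at h
  obtain ⟨rfl, rfl⟩ := h
  rfl

/-- By the chain condition the erased letters form a final segment, so the surviving letters keep
their positions. Erasing therefore looks like padding to a synchronous automaton. -/
theorem List.getElem?_filterMap_of_isChain {α β : Type*} (f : α → Option β) {l : List α}
    (h : l.IsChain fun a b => f a = none → f b = none) (i : ℕ) :
    (l.filterMap f)[i]? = l[i]?.bind f := by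
  have hnil : ∀ {l : List α} {a : α}, f a = none →
      (a :: l).IsChain (fun a b => f a = none → f b = none) → ∀ b ∈ l, f b = none := by
    intro l
    induction l with
    | nil => simp
    | cons c l ih =>
      intro a ha hc b hb
      rw [List.isChain_cons_cons] at hc
      rcases List.mem_cons.1 hb with rfl | hb
      · exact hc.1 ha
      · exact ih (hc.1 ha) hc.2 b hb
  induction l generalizing i with
  | nil => simp
  | cons a l ih =>
    cases ha : f a with
    | none =>
      have h0 := hnil ha h
      rw [List.filterMap_cons_none ha, List.filterMap_eq_nil_iff.2 h0]
      cases i with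
      | zero => simp [ha]
      | succ i =>
        rw [List.getElem?_cons_succ]
        cases hi : l[i]? with
        | none => simp
        | some b => simp [h0 b (List.mem_of_getElem? hi)]
    | some b =>
      rw [List.filterMap_cons_some ha]
      cases i with
      | zero => simp [ha]
      | succ i => simpa using ih h.tail i

/-! ### Synchronously regular relations -/

/-- The first `n` letters of the parallel reading of two words, with infinite padding. -/
def padTo {A B : Type*} (n : ℕ) (u : List A) (v : List B) : List (Option A × Option B) :=
  (List.range n).map fun i => (u[i]?, v[i]?)

/-- A relation between words is synchronously regular if a finite automaton reading both words in
parallel, with an arbitrary amount of padding, recognizes it. -/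
def SyncRegular {A B : Type} (R : List A → List B → Prop) : Prop :=
  ∃ P : Language (Option A × Option B), P.IsRegular ∧
    ∀ u v n, u.length ≤ n → v.length ≤ n → (padTo n u v ∈ P ↔ R u v)

section padTo

variable {A B : Type*}

theorem padTo_succ (n : ℕ) (u : List A) (v : List B) :
    padTo (n + 1) u v = (u[0]?, v[0]?) :: padTo n u.tail v.tail := by
  simp [padTo, List.range_succ_eq_map, Function.comp_def]

theorem padTo_append_replicate {n : ℕ} {u : List A} {v : List B} (hu : u.length ≤ n)
    (hv : v.length ≤ n) (k : ℕ) :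
    padTo n u v ++ List.replicate k (none, none) = padTo (n + k) u v := by
  rw [padTo, padTo, List.range_add, List.map_append, List.map_map]
  congr 1
  symm
  rw [List.eq_replicate_iff]
  refine ⟨by simp, ?_⟩
  simp only [List.mem_map, Function.comp_apply]
  rintro _ ⟨i, _, rfl⟩
  rw [List.getElem?_eq_none (by omega), List.getElem?_eq_none (by omega)]

theorem filterMap_getElem?_range {n : ℕ} {u : List A} (hu : u.length ≤ n) :
    (List.range n).filterMap (fun i => u[i]?) = u := by
  induction n generalizing u with
  | zero => simpa using hu
  | succ n ih =>
    cases u with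
    | nil => simp
    | cons a u =>
      have := ih (u := u) (by simpa using hu)
      rw [List.range_succ_eq_map, List.filterMap_cons_some (b := a) (by simp),
        List.filterMap_map]
      simpa [Function.comp_def] using this

theorem filterMap_fst_padTo {n : ℕ} {u : List A} (v : List B) (hu : u.length ≤ n) :
    (padTo n u v).filterMap Prod.fst = u := by
  rw [padTo, List.filterMap_map]
  exact filterMap_getElem?_range hu

theorem filterMap_snd_padTo {n : ℕ} (u : List A) {v : List B} (hv : v.length ≤ n) :
    (padTo n u v).filterMap Prod.snd = v := by
  rw [padTo, List.filterMap_map]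
  exact filterMap_getElem?_range hv

theorem padTo_max (u v : List A) :
    padTo (max u.length v.length) u v = (padPair u v).map Subtype.val := by
  induction u generalizing v with
  | nil =>
    rw [padPair, List.map_map]
    refine List.ext_getElem? fun i => ?_
    by_cases h : i < v.length
    · simp [padTo, h]
    · simp [padTo, h]
  | cons a u ih =>
    cases v with
    | nil =>
      have := ih []
      simp only [List.length_nil, zero_le, sup_of_le_left] at this
      simp [padPair, padTo_succ, this]
    | cons b v =>
      simp [padPair, padTo_succ, ih, Nat.succ_max_succ]

theorem padPair_injective {u v u' v' : List A} (h : padPair u v = padPair u' v') :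
    u = u' ∧ v = v' := by
  have h1 : padTo (max u.length v.length) u v = padTo (max u'.length v'.length) u' v' := by
    rw [padTo_max, padTo_max, h]
  constructor
  · rw [← filterMap_fst_padTo (u := u) v (le_max_left _ _), h1,
      filterMap_fst_padTo _ (le_max_left _ _)]
  · rw [← filterMap_snd_padTo u (v := v) (le_max_right _ _), h1,
      filterMap_snd_padTo _ (le_max_right _ _)]

end padTo

namespace SyncRegular

variable {A B C : Type}

theorem congr {R R' : List A → List B → Prop} (h : SyncRegular R) (e : ∀ u v, R' u v ↔ R u v) :
    SyncRegular R' := by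
  rwa [show R' = R from funext fun u => funext fun v => propext (e u v)]

theorem and {R R' : List A → List B → Prop} (h : SyncRegular R) (h' : SyncRegular R') :
    SyncRegular fun u v => R u v ∧ R' u v := by
  obtain ⟨P, hP, hR⟩ := h
  obtain ⟨P', hP', hR'⟩ := h'
  exact ⟨_, hP.and hP', fun u v n hu hv => and_congr (hR u v n hu hv) (hR' u v n hu hv)⟩

theorem iInter {ι : Type*} [Finite ι] {R : ι → List A → List B → Prop}
    (h : ∀ i, SyncRegular (R i)) : SyncRegular fun u v => ∀ i, R i u v := by
  choose P hP hR using h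
  exact ⟨_, Language.isRegular_forall hP, fun u v n hu hv =>
    forall_congr' fun i => hR i u v n hu hv⟩

theorem iUnion {ι : Type*} [Finite ι] {R : ι → List A → List B → Prop}
    (h : ∀ i, SyncRegular (R i)) : SyncRegular fun u v => ∃ i, R i u v := by
  choose P hP hR using h
  exact ⟨_, Language.isRegular_exists hP, fun u v n hu hv =>
    exists_congr fun i => hR i u v n hu hv⟩

theorem left {P : Language A} (h : P.IsRegular) :
    SyncRegular fun (u : List A) (_ : List B) => u ∈ P :=
  ⟨_, h.preimage_filterMap Prod.fst, fun u v n hu _ => by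
    change (padTo n u v).filterMap Prod.fst ∈ P ↔ _
    rw [filterMap_fst_padTo v hu]⟩

theorem right {P : Language B} (h : P.IsRegular) :
    SyncRegular fun (_ : List A) (v : List B) => v ∈ P :=
  ⟨_, h.preimage_filterMap Prod.snd, fun u v n _ hv => by
    change (padTo n u v).filterMap Prod.snd ∈ P ↔ _
    rw [filterMap_snd_padTo u hv]⟩

/-- Three tracks are read in parallel and the middle one is projected away. The chain condition
makes the middle track an honest padded word; the quotient is needed because that word may be longer
than both outer words. -/
theorem comp [Finite B] {R : List A → List B → Prop} {Q : List B → List C → Prop}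
    (hR : SyncRegular R) (hQ : SyncRegular Q) : SyncRegular fun u w => ∃ v, R u v ∧ Q v w := by
  obtain ⟨P, hP, hR⟩ := hR
  obtain ⟨P', hP', hQ⟩ := hQ
  have hV := Language.isRegular_isChain (α := Option B) (fun a b => a = none → b = none)
    (fun _ => True)
  refine ⟨_, ((((hP.preimage_map fun x : Option A × Option B × Option C => (x.1, x.2.1)).and
    (hP'.preimage_map fun x : Option A × Option B × Option C => x.2)).and
    (hV.preimage_map fun x => x.2.1)).image_map fun x => (x.1, x.2.2)).quotient_replicate
      (none, none), fun u w n hu hw => ?_⟩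
  change (∃ k, ∃ l : List (Option A × Option B × Option C),
    ((l.map (fun x => (x.1, x.2.1)) ∈ P ∧ l.map (fun x => x.2) ∈ P') ∧
      ((l.map (fun x => x.2.1)).IsChain (fun a b => a = none → b = none) ∧
        ∀ a ∈ (l.map (fun x => x.2.1)).getLast?, True)) ∧
    l.map (fun x => (x.1, x.2.2)) = padTo n u w ++ List.replicate k (none, none)) ↔ _
  constructor
  · rintro ⟨k, l, ⟨⟨h1, h2⟩, hc, -⟩, h3⟩
    -- The middle word is recovered by erasing the padding of its track, which does not move its
    -- letters.
    rw [padTo_append_replicate hu hw] at h3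
    have hlen : l.length = n + k := by simpa [padTo] using congrArg List.length h3
    have hv := List.getElem?_filterMap_of_isChain (f := id) hc
    have hvl : ((l.map fun x => x.2.1).filterMap id).length ≤ n + k := by
      refine (List.length_filterMap_le _ _).trans ?_
      simp [hlen]
    obtain ⟨v, hv, hvl⟩ : ∃ v : List B,
        (∀ i, v[i]? = (l.map fun x => x.2.1)[i]?.bind id) ∧ v.length ≤ n + k := ⟨_, hv, hvl⟩
    have h3i : ∀ i < n + k, (l[i]?).map (fun x => (x.1, x.2.2)) = some (u[i]?, w[i]?) := by
      intro i hi
      rw [← List.getElem?_map, h3]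
      simp [padTo, hi]
    refine ⟨v, ?_, ?_⟩
    · rw [← hR _ _ (n + k) (by omega) hvl]
      convert h1 using 1
      refine List.ext_getElem? fun i => ?_
      by_cases hi : i < n + k
      · have hi' := h3i i hi
        obtain ⟨x, hx⟩ : ∃ x, l[i]? = some x := ⟨l[i]'(by omega), by simp [hlen, hi]⟩
        have h4 := hv i
        simp only [hx, Option.map_some, Option.some.injEq, Prod.mk.injEq] at hi'
        simp only [List.getElem?_map, hx, Option.map_some, Option.bind_some, id] at h4
        simp [padTo, hi, hx, hi'.1, h4]
      · simp [padTo, hi, hlen]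
    · rw [← hQ _ _ (n + k) hvl (by omega)]
      convert h2 using 1
      refine List.ext_getElem? fun i => ?_
      by_cases hi : i < n + k
      · have hi' := h3i i hi
        obtain ⟨x, hx⟩ : ∃ x, l[i]? = some x := ⟨l[i]'(by omega), by simp [hlen, hi]⟩
        have h4 := hv i
        simp only [hx, Option.map_some, Option.some.injEq, Prod.mk.injEq] at hi'
        simp only [List.getElem?_map, hx, Option.map_some, Option.bind_some, id] at h4
        simp [padTo, hi, hx, ← hi'.2, h4]
      · simp [padTo, hi, hlen]
  · rintro ⟨v, h1, h2⟩
    -- Adding `v.length` columns of padding leaves enough room for the middle word.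
    refine ⟨v.length, (List.range (n + v.length)).map fun i => (u[i]?, v[i]?, w[i]?),
      ⟨⟨?_, ?_⟩, ?_, fun _ _ => trivial⟩, ?_⟩
    · rw [List.map_map]
      exact (hR u v _ (by omega) (by omega)).2 h1
    · rw [List.map_map]
      exact (hQ v w _ (by omega) (by omega)).2 h2
    · rw [List.isChain_iff_getElem]
      intro i hi
      simp only [List.getElem_map, List.getElem_range, List.getElem?_eq_none_iff]
      omega
    · rw [padTo_append_replicate hu hw, List.map_map]
      rfl

/-- Relations are pulled back along letter-to-letter maps that erase only final letters. -/
theorem preimage_filterMap [Finite A] {R : List B → List B → Prop} (hR : SyncRegular R)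
    (f : A → Option B) :
    SyncRegular fun u v => u.IsChain (fun a b => f a = none → f b = none) ∧
      v.IsChain (fun a b => f a = none → f b = none) ∧ R (u.filterMap f) (v.filterMap f) := by
  obtain ⟨P, hP, hR⟩ := hR
  have hV := Language.isRegular_isChain (fun a b : A => f a = none → f b = none) (fun _ => True)
  have hP' := hP.preimage_map fun x : Option A × Option A => (x.1.bind f, x.2.bind f)
  refine ⟨_, ((hV.preimage_filterMap Prod.fst).and (hV.preimage_filterMap Prod.snd)).and hP',
    fun u v n hu hv => ?_⟩
  change ((((padTo n u v).filterMap Prod.fst).IsChain _ ∧ ∀ a ∈ _, True) ∧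
    (((padTo n u v).filterMap Prod.snd).IsChain _ ∧ ∀ a ∈ _, True)) ∧
    (padTo n u v).map (fun x => (x.1.bind f, x.2.bind f)) ∈ P ↔ _
  rw [filterMap_fst_padTo v hu, filterMap_snd_padTo u hv]
  simp only [implies_true, and_true, and_assoc]
  refine and_congr_right fun h1 => and_congr_right fun h2 => ?_
  rw [← hR _ _ n ((List.length_filterMap_le _ _).trans hu)
    ((List.length_filterMap_le _ _).trans hv)]
  -- Erasing a final segment commutes with reading the `i`-th letter.
  simp only [padTo, List.map_map, Function.comp_def, List.getElem?_filterMap_of_isChain f h1,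
    List.getElem?_filterMap_of_isChain f h2]

end SyncRegular

/-! ### Padded languages and synchronous relations -/

theorem isRegular_range_padPair (A : Type) :
    Language.IsRegular ({l | ∃ u v, padPair u v = l} : Language (PaddedPair A)) := by
  -- The two flags record which of the words has ended; a letter on an ended track leads to the sink
  -- `none`.
  let step : Option (Bool × Bool) → PaddedPair A → Option (Bool × Bool) := fun s x =>
    s.bind fun b => if (b.1 && x.1.1.isSome) || (b.2 && x.1.2.isSome) then none
      else some (x.1.1.isNone, x.1.2.isNone)
  have hnone : ∀ l : List (PaddedPair A), l.foldl step none = none := by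
    intro l; induction l with
    | nil => rfl
    | cons a l ih => exact ih
  have key : ∀ (l : List (PaddedPair A)) (b : Bool × Bool), l.foldl step (some b) ≠ none ↔
      ∃ u v, padPair u v = l ∧ (b.1 = true → u = []) ∧ (b.2 = true → v = []) := by
    intro l
    induction l with
    | nil => intro b; simpa using ⟨[], [], rfl, by simp, by simp⟩
    | cons x l ih =>
      rintro ⟨b1, b2⟩
      obtain ⟨⟨_ | a, _ | c⟩, hx⟩ := x
      · exact absurd rfl hx
      · cases b2
        · simp only [List.foldl_cons]
          rw [show step (some (b1, false)) ⟨(none, some c), hx⟩ = some (true, false) by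
            simp [step], ih]
          constructor
          · rintro ⟨u, v, rfl, h1, -⟩
            obtain rfl := h1 rfl
            exact ⟨[], c :: v, by simp [padPair], by simp, by simp⟩
          · rintro ⟨u, v, h, h1, -⟩
            rcases u with _ | ⟨a, u⟩
            · rcases v with _ | ⟨b, v⟩
              · simp [padPair] at h
              · exact ⟨[], v, by simpa [padPair] using (List.cons.inj h).2, by simp, by simp⟩
            · rcases v with _ | ⟨b, v⟩ <;> simp [padPair] at h
        · simp only [List.foldl_cons]
          rw [show step (some (b1, true)) ⟨(none, some c), hx⟩ = none by simp [step], hnone]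
          simp only [ne_eq, not_true_eq_false, false_iff]
          rintro ⟨u, v, h, h1, h2⟩
          obtain rfl := h2 trivial
          rcases u with _ | ⟨a, u⟩ <;> simp [padPair] at h
      · cases b1
        · simp only [List.foldl_cons]
          rw [show step (some (false, b2)) ⟨(some a, none), hx⟩ = some (false, true) by
            simp [step], ih]
          constructor
          · rintro ⟨u, v, rfl, -, h1⟩
            obtain rfl := h1 rfl
            exact ⟨a :: u, [], by simp [padPair], by simp, by simp⟩
          · rintro ⟨u, v, h, h1, -⟩
            rcases v with _ | ⟨b, v⟩
            · rcases u with _ | ⟨b, u⟩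
              · simp [padPair] at h
              · exact ⟨u, [], by simpa [padPair] using (List.cons.inj h).2, by simp, by simp⟩
            · rcases u with _ | ⟨b, u⟩ <;> simp [padPair] at h
        · simp only [List.foldl_cons]
          rw [show step (some (true, b2)) ⟨(some a, none), hx⟩ = none by simp [step], hnone]
          simp only [ne_eq, not_true_eq_false, false_iff]
          rintro ⟨u, v, h, h1, h2⟩
          obtain rfl := h1 trivial
          rcases v with _ | ⟨a, v⟩ <;> simp [padPair] at h
      · simp only [List.foldl_cons]
        by_cases hb : b1 = false ∧ b2 = false
        · obtain ⟨rfl, rfl⟩ := hb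
          rw [show step (some (false, false)) ⟨(some a, some c), hx⟩ = some (false, false) by
            simp [step], ih]
          constructor
          · rintro ⟨u, v, rfl, -, -⟩
            exact ⟨a :: u, c :: v, by simp [padPair], by simp, by simp⟩
          · rintro ⟨u, v, h, -, -⟩
            rcases u with _ | ⟨a', u⟩ <;> rcases v with _ | ⟨c', v⟩ <;> simp [padPair] at h
            exact ⟨u, v, h.2, by simp, by simp⟩
        · rw [show step (some (b1, b2)) ⟨(some a, some c), hx⟩ = none by
            cases b1 <;> cases b2 <;> simp [step] at hb ⊢, hnone]
          simp only [ne_eq, not_true_eq_false, false_iff]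
          rintro ⟨u, v, h, h1, h2⟩
          rcases u with _ | ⟨a', u⟩ <;> rcases v with _ | ⟨c', v⟩ <;> simp [padPair] at h
          simp at h1 h2
          exact hb ⟨h1, h2⟩
  refine (Language.isRegular_foldl step (some (false, false)) {s | s ≠ none}).congr fun l => ?_
  change (∃ u v, padPair u v = l) ↔ l.foldl step (some (false, false)) ≠ none
  rw [key]; simp

/-- The relation on lists of letters given by a relation on `A⁺`. -/
def lettersRel {A : Type*} (R : Set (FreeSemigroup A × FreeSemigroup A)) (u v : List A) : Prop :=
  ∃ p ∈ R, p.1.letters = u ∧ p.2.letters = v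

/-- In one direction surplus columns `(none, none)` are deleted. In the other, the recognizing
language is unconstrained off genuine parallel readings, so it is intersected with the range of
`padPair`. -/
theorem isRegular_paddedLanguage_iff {A : Type} {R : Set (FreeSemigroup A × FreeSemigroup A)} :
    (paddedLanguage R).IsRegular ↔ SyncRegular (lettersRel R) := by
  have hmem : ∀ u v, padPair u v ∈ paddedLanguage R ↔ lettersRel R u v := by
    intro u v
    constructor
    · rintro ⟨p, hp, h⟩
      obtain ⟨h1, h2⟩ := padPair_injective h
      exact ⟨p, hp, h1, h2⟩
    · rintro ⟨p, hp, rfl, rfl⟩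
      exact ⟨p, hp, rfl⟩
  constructor
  · intro h
    classical
    refine ⟨_, h.preimage_filterMap fun x : Option A × Option A =>
      if hx : x ≠ (none, none) then some ⟨x, hx⟩ else none, fun u v n hu hv => ?_⟩
    change (padTo n u v).filterMap _ ∈ paddedLanguage R ↔ _
    rw [← hmem]
    obtain ⟨k, hk⟩ := Nat.exists_eq_add_of_le (max_le hu hv)
    rw [hk, ← padTo_append_replicate (le_max_left _ _) (le_max_right _ _), padTo_max,
      List.filterMap_append, List.filterMap_map]
    have h1 : (List.replicate k ((none, none) : Option A × Option A)).filterMap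
        (fun x => if hx : x ≠ (none, none) then some (⟨x, hx⟩ : PaddedPair A) else none) = [] := by
      rw [List.filterMap_eq_nil_iff]
      intro x hx
      rw [List.eq_of_mem_replicate hx]
      simp
    have h2 : ((fun x : Option A × Option A =>
        if hx : x ≠ (none, none) then some (⟨x, hx⟩ : PaddedPair A) else none) ∘
          (Subtype.val : PaddedPair A → _)) = some := by
      funext x
      simp only [Function.comp_apply]
      rw [dif_pos x.2]
    rw [h1, h2]
    simp
  · rintro ⟨P, hP, h⟩
    refine ((isRegular_range_padPair A).and (hP.preimage_map Subtype.val)).congr fun l => ?_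
    change l ∈ paddedLanguage R ↔ (∃ u v, padPair u v = l) ∧ l.map Subtype.val ∈ P
    constructor
    · rintro ⟨p, hp, rfl⟩
      refine ⟨⟨_, _, rfl⟩, ?_⟩
      rw [← padTo_max, h _ _ _ (le_max_left _ _) (le_max_right _ _)]
      exact ⟨p, hp, rfl, rfl⟩
    · rintro ⟨⟨u, v, rfl⟩, h'⟩
      rw [← padTo_max, h _ _ _ (le_max_left _ _) (le_max_right _ _)] at h'
      exact (hmem u v).2 h'

/-! ### Finite generation of wreath products -/

theorem FreeSemigroup.lift_comp_mulEquiv {A S S' : Type*} [Semigroup S] [Semigroup S'] (f : S ≃* S')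
    (ψ : A → S) (w : FreeSemigroup A) :
    FreeSemigroup.lift (f ∘ ψ) w = f (FreeSemigroup.lift ψ w) := by
  have : FreeSemigroup.lift (f ∘ ψ) = (f : S →ₙ* S').comp (FreeSemigroup.lift ψ) :=
    FreeSemigroup.hom_ext rfl
  rw [this]; rfl

theorem IsFinitelyGeneratedSemigroup.of_mulEquiv {S S' : Type*} [Semigroup S] [Semigroup S']
    (f : S ≃* S') (h : IsFinitelyGeneratedSemigroup S) : IsFinitelyGeneratedSemigroup S' := by
  obtain ⟨A, hA, hA', ψ, hψ⟩ := h
  refine ⟨A, hA, hA', f ∘ ψ, fun s => ?_⟩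
  obtain ⟨w, hw⟩ := hψ (f.symm s)
  exact ⟨w, by rw [FreeSemigroup.lift_comp_mulEquiv, hw, f.apply_symm_apply]⟩

theorem IsAutomaticSemigroup.of_mulEquiv {S S' : Type*} [Semigroup S] [Semigroup S']
    (f : S ≃* S') (h : IsAutomaticSemigroup S) : IsAutomaticSemigroup S' := by
  obtain ⟨A, hA, hA', ψ, L, h⟩ := h
  have hlift := FreeSemigroup.lift_comp_mulEquiv f ψ
  refine ⟨A, hA, hA', f ∘ ψ, L, fun s => ?_, h.regular, Set.eq_univ_of_forall fun s => ?_, ?_,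
    fun a => ?_⟩
  · obtain ⟨w, hw⟩ := h.generates (f.symm s)
    exact ⟨w, by rw [hlift, hw, f.apply_symm_apply]⟩
  · obtain ⟨w, hw, hw'⟩ := h.image_eq.ge (Set.mem_univ (f.symm s))
    exact ⟨w, hw, by rw [hlift, hw', f.apply_symm_apply]⟩
  · simpa only [hlift, f.injective.eq_iff] using h.regular_eq
  · simpa only [hlift, Function.comp_apply, ← map_mul, f.injective.eq_iff] using h.regular_mul a

theorem FreeSemigroup.lift_eq_or_mul {A S : Type*} [Semigroup S] (ψ : A → S)
    (w : FreeSemigroup A) :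
    (∃ a, FreeSemigroup.lift ψ w = ψ a) ∨ ∃ a s, FreeSemigroup.lift ψ w = ψ a * s := by
  induction w using FreeSemigroup.recOnMul with
  | ih1 a => exact Or.inl ⟨a, rfl⟩
  | ih2 a w _ _ => exact Or.inr ⟨a, FreeSemigroup.lift ψ w, by rw [FreeSemigroup.lift_of_mul]⟩

theorem FreeSemigroup.lift_eq_or_mul' {A S : Type*} [Semigroup S] (ψ : A → S)
    (w : FreeSemigroup A) :
    (∃ a, FreeSemigroup.lift ψ w = ψ a) ∨ ∃ s a, FreeSemigroup.lift ψ w = s * ψ a := by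
  induction w using FreeSemigroup.recOnMul with
  | ih1 a => exact Or.inl ⟨a, rfl⟩
  | ih2 a w _ ih =>
    right
    rw [FreeSemigroup.lift_of_mul]
    obtain ⟨b, hb⟩ | ⟨s, b, hb⟩ := ih
    · exact ⟨_, b, by rw [hb]⟩
    · exact ⟨_, b, by rw [hb, mul_assoc]⟩

namespace UnrestrictedWreath

variable {S T : Type*} [Semigroup S] [Semigroup T]

@[simp] theorem base_mul (p q : UnrestrictedWreath S T) (x : T) :
    (p * q).base x = p.base x * q.base (x * p.top) := rfl

@[simp] theorem top_mul (p q : UnrestrictedWreath S T) : (p * q).top = p.top * q.top := rfl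

/-- If the diagonal act is not finitely generated, finite generation of the wreath product makes
every element of `T` a right multiple of an element acting injectively on `T` from the right. -/
theorem exists_injective_mul_right [Finite T] (hdiag : ¬ (diagonalAct S).IsFinitelyGenerated)
    (hfg : IsFinitelyGeneratedSemigroup (UnrestrictedWreath S T)) (t : T) :
    ∃ t', Function.Injective (· * t' : T → T) ∧ (t = t' ∨ ∃ v, t = t' * v) := by
  classical
  obtain ⟨B, -, _, φ, hφ⟩ := hfg
  let ker : T → Set (T × T) := fun t => {p | p.1 * t = p.2 * t}
  let Q : Set T := {t' | t = t' ∨ ∃ v, t = t' * v}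
  -- Among `t` and its left divisors, take one whose right translation identifies the fewest pairs.
  obtain ⟨t', ht', hmin⟩ := Set.exists_min_image Q (fun t => (ker t).ncard) (Set.toFinite Q)
    ⟨t, Or.inl rfl⟩
  refine ⟨t', fun x y hxy => ?_, ht'⟩
  by_contra hne
  refine hdiag ⟨Set.range fun b => ((φ b).base x, (φ b).base y), Set.finite_range _, ?_⟩
  rintro ⟨s₁, s₂⟩
  -- If `x t' = y t'` with `x ≠ y`, splitting off the first generator of this element shows that
  -- `(s₁, s₂)` is reached in the diagonal act from one of finitely many pairs.
  obtain ⟨w, hw⟩ := hφ ⟨fun z => if z = x then s₁ else s₂, t'⟩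
  obtain ⟨b, hb⟩ | ⟨b, p, hb⟩ := FreeSemigroup.lift_eq_or_mul φ w
  · left
    refine ⟨b, ?_⟩
    dsimp only
    rw [← hb, hw]
    simp [Ne.symm hne]
  · right
    refine ⟨_, ⟨b, rfl⟩, p.base (x * (φ b).top), ?_⟩
    rw [hb] at hw
    have htop : (φ b).top * p.top = t' := congrArg UnrestrictedWreath.top hw
    have hQ : (φ b).top ∈ Q := by
      rcases ht' with rfl | ⟨v, rfl⟩
      · exact Or.inr ⟨_, htop.symm⟩
      · exact Or.inr ⟨p.top * v, by rw [← mul_assoc, htop]⟩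
    have hsub : ker (φ b).top ⊆ ker t' := by
      rintro ⟨z, z'⟩ (hz : z * _ = z' * _)
      change z * t' = z' * t'
      rw [← htop, ← mul_assoc, hz, mul_assoc]
    -- By minimality the first generator already sends `x` and `y` to the same point, so the
    -- remaining factor contributes the same element of `S` at both coordinates.
    have hker : ker (φ b).top = ker t' :=
      Set.eq_of_subset_of_ncard_le hsub (hmin _ hQ) (Set.toFinite _)
    have hmem : (x, y) ∈ ker (φ b).top := by rw [hker]; exact hxy
    have hx : (φ b).base x * p.base (x * (φ b).top) = s₁ := by
      simpa using congrFun (congrArg UnrestrictedWreath.base hw) x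
    have hy : (φ b).base y * p.base (y * (φ b).top) = s₂ := by
      simpa [Ne.symm hne] using congrFun (congrArg UnrestrictedWreath.base hw) y
    have hmem' : x * (φ b).top = y * (φ b).top := hmem
    rw [← hmem'] at hy
    simp [diagonalAct, hx, hy]

/-- Every element of `T` is a right multiple of a right identity. -/
theorem exists_rightIdentity_mul [Finite T] (hdiag : ¬ (diagonalAct S).IsFinitelyGenerated)
    (hfg : IsFinitelyGeneratedSemigroup (UnrestrictedWreath S T)) (t : T) :
    ∃ r u : T, (∀ x, x * r = x) ∧ t = r * u := by
  obtain ⟨t', hinj, ht⟩ := exists_injective_mul_right hdiag hfg t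
  -- From `r t' = t'` follows `x r t' = x t'`, and cancelling `t'` makes `r` a right identity.
  obtain ⟨r, hr⟩ := Finite.surjective_of_injective hinj t'
  have hr' : r * t' = t' := hr
  have hid : ∀ x, x * r = x := fun x => hinj (by
    change x * r * t' = x * t'
    rw [mul_assoc, hr'])
  rcases ht with rfl | ⟨v, rfl⟩
  · exact ⟨r, t, hid, hr'.symm⟩
  · exact ⟨r, t' * v, hid, by rw [← mul_assoc, hr']⟩

/-- If `s` were indecomposable, every element of the wreath product with value `s` at one coordinate
would be a generator. The value at a second coordinate is arbitrary, so there would be infinitely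
many generators. -/
theorem eq_mul_of_isFinitelyGenerated [Infinite S] [Nontrivial T]
    (hfg : IsFinitelyGeneratedSemigroup (UnrestrictedWreath S T)) (s : S) :
    ∃ s₁ s₂ : S, s = s₁ * s₂ := by
  classical
  by_contra hs
  push Not at hs
  obtain ⟨B, -, _, φ, hφ⟩ := hfg
  obtain ⟨x, y, hxy⟩ := exists_pair_ne T
  refine Set.infinite_univ (α := S) ((Set.finite_range fun b => (φ b).base y).subset
    fun s' _ => ?_)
  obtain ⟨w, hw⟩ := hφ ⟨fun z => if z = x then s else s', x⟩
  obtain ⟨b, hb⟩ | ⟨b, p, hb⟩ := FreeSemigroup.lift_eq_or_mul φ w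
  · refine ⟨b, ?_⟩
    dsimp only
    rw [← hb, hw]
    simp [hxy.symm]
  · rw [hb] at hw
    have hx : (φ b).base x * p.base (x * (φ b).top) = s := by
      simpa using congrFun (congrArg UnrestrictedWreath.base hw) x
    exact absurd hx.symm (hs _ _)

/-- The wreath product with a trivial semigroup. -/
def mulEquivOfUnique [Unique T] : S ≃* UnrestrictedWreath S T where
  toFun s := ⟨fun _ => s, default⟩
  invFun p := p.base default
  left_inv _ := rfl
  right_inv p := UnrestrictedWreath.ext (funext fun x => by rw [Unique.eq_default x])
    (Unique.eq_default _).symm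
  map_mul' s s' := UnrestrictedWreath.ext rfl (Unique.eq_default _).symm

end UnrestrictedWreath

theorem infinite_of_diagonalAct {S : Type*} [Semigroup S]
    (hdiag : ¬ (diagonalAct S).IsFinitelyGenerated) : Infinite S := by
  by_contra h
  rw [not_infinite_iff_finite] at h
  exact hdiag ⟨Set.univ, Set.toFinite _, fun x => Or.inl trivial⟩

/-- In a finitely generated semigroup with `S = S²`, every element has a factor on the right that
absorbs some element from the left. -/
theorem exists_eq_mul_and_mul_eq {A S : Type*} [Semigroup S] [Finite A] {ψ : A → S}
    (hψ : IsGeneratingMap ψ) (hS : ∀ s : S, ∃ s₁ s₂ : S, s = s₁ * s₂) (s : S) :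
    ∃ p q z : S, s = p * z ∧ z = q * z := by
  have hstep : ∀ s : S, ∃ (a : A) (s' : S), s = s' * ψ a := by
    intro s
    obtain ⟨s₁, s₂, rfl⟩ := hS s
    obtain ⟨w, rfl⟩ := hψ s₂
    obtain ⟨a, ha⟩ | ⟨s', a, ha⟩ := FreeSemigroup.lift_eq_or_mul' ψ w
    · exact ⟨a, s₁, by rw [ha]⟩
    · exact ⟨a, s₁ * s', by rw [ha, mul_assoc]⟩
  -- `β a` is the last letter of a proper factorization of `ψ a`; iterating it gives ever longer
  -- factorizations from the right.
  choose β w hβ using fun a => hstep (ψ a)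
  obtain ⟨a, s', rfl⟩ := hstep s
  have hiter : ∀ (k : ℕ) (b : A), ∃ v, ψ b = v * ψ (β^[k + 1] b) := by
    intro k
    induction k with
    | zero => exact fun b => ⟨w b, hβ b⟩
    | succ k ih =>
      intro b
      obtain ⟨v, hv⟩ := ih (β b)
      refine ⟨w b * v, ?_⟩
      rw [Function.iterate_succ_apply, mul_assoc, ← hv]
      exact hβ b
  -- The alphabet is finite, so the orbit of `β` repeats. The letter on the cycle gives `z`, and one
  -- turn around the cycle gives `z = q z`.
  obtain ⟨i, j, hij, heq⟩ : ∃ i j, i < j ∧ β^[i + 1] a = β^[j + 1] a := by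
    obtain ⟨i, j, hne, h⟩ := Finite.exists_ne_map_eq_of_infinite fun i : ℕ => β^[i + 1] a
    rcases lt_or_gt_of_ne hne with h' | h'
    · exact ⟨i, j, h', h⟩
    · exact ⟨j, i, h', h.symm⟩
  obtain ⟨v, hv⟩ := hiter i a
  obtain ⟨q, hq⟩ := hiter (j - i - 1) (β^[i + 1] a)
  rw [← Function.iterate_add_apply, show j - i - 1 + 1 + (i + 1) = j + 1 by omega, ← heq] at hq
  exact ⟨s' * v, q, ψ (β^[i + 1] a), by rw [mul_assoc, ← hv], hq⟩

/-! ### Stretched words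

If every generator `a` has a factorization `a = p z` with `z = q z`, a word `u a` represents the
same element as `u p qᵏ z` for every `k`. -/

/-- The letters of stretched words over `A`. -/
inductive StretchLetter (A : Type)
  | plain (a : A)
  | start (a : A)
  | loop (a : A)
  | final (a : A)

namespace StretchLetter

variable {A : Type} {S : Type*} [Semigroup S]

instance [Finite A] : Finite (StretchLetter A) :=
  Finite.of_surjective
    (fun x : (A ⊕ A) ⊕ (A ⊕ A) =>
      x.elim (Sum.elim plain start) (Sum.elim loop final)) (by
      rintro (a | a | a | a)
      exacts [⟨.inl (.inl a), rfl⟩, ⟨.inl (.inr a), rfl⟩, ⟨.inr (.inl a), rfl⟩,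
        ⟨.inr (.inr a), rfl⟩])

/-- The original letter at this position, or `none` in the added tail. -/
def decode : StretchLetter A → Option A
  | plain a => some a
  | start a => some a
  | loop _ => none
  | final _ => none

/-- The letters allowed to follow each other. -/
def Follows : StretchLetter A → StretchLetter A → Prop
  | plain _, d => d.decode.isSome
  | start a, d => d = loop a ∨ d = final a
  | loop a, d => d = loop a ∨ d = final a
  | final _, _ => False

/-- The last letter of a stretched word. -/
def IsFinal : StretchLetter A → Prop
  | final _ => True
  | _ => False

theorem Follows.decode_eq_none {d d' : StretchLetter A} (h : d.Follows d') (hd : d.decode = none) :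
    d'.decode = none := by
  rcases d with a | a | a | a
  · simp [decode] at hd
  · simp [decode] at hd
  · rcases h with rfl | rfl <;> rfl
  · exact h.elim

/-- The element of `S` denoted by a letter. -/
def val (ψ p q z : A → S) : StretchLetter A → S
  | plain a => ψ a
  | start a => p a
  | loop a => q a
  | final a => z a

/-- A stretched word represents the same element as the word it is stretched from. -/
theorem lift_val {ψ p q z : A → S} (hp : ∀ a, ψ a = p a * z a) (hq : ∀ a, z a = q a * z a)
    (d : StretchLetter A) (l : List (StretchLetter A)) (hl : (d :: l).IsChain Follows)
    (hlast : ∀ c ∈ (d :: l).getLast?, c.IsFinal) :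
    (∀ a : A, d = loop a ∨ d = final a →
      FreeSemigroup.lift (val ψ p q z) ⟨d, l⟩ = z a ∧ (d :: l).filterMap decode = []) ∧
    (d.decode.isSome → ∀ α : FreeSemigroup A, α.letters = (d :: l).filterMap decode →
      FreeSemigroup.lift (val ψ p q z) ⟨d, l⟩ = FreeSemigroup.lift ψ α) := by
  -- The value collapses from the right: each loop letter `q a` is absorbed by `z a`, and the start
  -- letter completes `p a * z a = ψ a`.
  induction l generalizing d with
  | nil =>
    have hd := hlast d (by simp)
    rcases d with a | a | a | a <;> simp only [IsFinal] at hd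
    refine ⟨?_, by simp [decode]⟩
    rintro b (h | h)
    · cases h
    · cases h
      exact ⟨rfl, rfl⟩
  | cons d' l ih =>
    rw [List.isChain_cons_cons] at hl
    have ih := ih d' hl.2 (by simpa [List.getLast?_cons_cons] using hlast)
    have hmul : FreeSemigroup.lift (val ψ p q z) ⟨d, d' :: l⟩ =
        val ψ p q z d * FreeSemigroup.lift (val ψ p q z) ⟨d', l⟩ :=
      FreeSemigroup.lift_of_mul (val ψ p q z) d ⟨d', l⟩
    rw [hmul]
    rcases d with a | a | a | a
    · refine ⟨by simp, fun _ α hα => ?_⟩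
      have hd' : d'.decode.isSome := hl.1
      obtain ⟨b, hb⟩ := Option.isSome_iff_exists.1 hd'
      rw [List.filterMap_cons_some (f := decode) (b := a) rfl, List.filterMap_cons_some hb] at hα
      obtain ⟨c, m⟩ := α
      obtain ⟨rfl, rfl⟩ := List.cons.inj hα
      rw [ih.2 hd' ⟨b, l.filterMap decode⟩ (by rw [List.filterMap_cons_some hb]; rfl)]
      exact (FreeSemigroup.lift_of_mul ψ c ⟨b, l.filterMap decode⟩).symm
    · refine ⟨by simp, fun _ α hα => ?_⟩
      obtain ⟨h1, h2⟩ := ih.1 a hl.1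
      rw [List.filterMap_cons_some (f := decode) (b := a) rfl, h2] at hα
      obtain ⟨c, m⟩ := α
      obtain ⟨rfl, rfl⟩ := List.cons.inj hα
      rw [h1]
      exact (hp c).symm
    · refine ⟨?_, by simp [decode]⟩
      obtain ⟨h1, h2⟩ := ih.1 a hl.1
      rintro b (h | h) <;> cases h
      rw [h1, List.filterMap_cons_none rfl, h2]
      exact ⟨(hq a).symm, rfl⟩
    · exact hl.1.elim

/-- A word can be stretched to every greater length. -/
theorem exists_stretch (α : FreeSemigroup A) (n : ℕ) (hn : α.letters.length < n) :
    ∃ l : List (StretchLetter A), l.length = n ∧ l.IsChain Follows ∧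
      (∀ d ∈ l.getLast?, d.IsFinal) ∧ l.filterMap decode = α.letters := by
  have htail : ∀ (a : A) (k : ℕ),
      (List.replicate k (loop a) ++ [final a]).IsChain Follows ∧
      (List.replicate k (loop a) ++ [final a]).filterMap decode = [] := by
    intro a k
    constructor
    · induction k with
      | zero => exact List.isChain_singleton _
      | succ k ih =>
        cases k with
        | zero => simp [Follows]
        | succ k =>
          rw [List.replicate_succ, List.cons_append] at ih ⊢
          rw [List.replicate_succ, List.cons_append, List.isChain_cons_cons]
          exact ⟨Or.inl rfl, ih⟩
    · simp [decode]
  obtain ⟨a, u, hα⟩ : ∃ a u, α.letters = u ++ [a] := by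
    obtain ⟨b, m⟩ := α
    exact ⟨(b :: m).getLast (by simp), (b :: m).dropLast, by
      rw [List.dropLast_append_getLast]; rfl⟩
  rw [hα] at hn ⊢
  have hn' : u.length + 1 < n := by simpa using hn
  -- The last letter is replaced by at least two letters, `start` and `final`, hence the strict
  -- bound; `k` loops fill the rest.
  obtain ⟨k, rfl⟩ := Nat.exists_eq_add_of_lt hn'
  refine ⟨u.map plain ++ start a :: (List.replicate k (loop a) ++ [final a]), by simp; omega,
    ?_, ?_, ?_⟩
  · have hstart : (start a :: (List.replicate k (loop a) ++ [final a])).IsChain Follows := by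
      cases k with
      | zero => simp [Follows]
      | succ k =>
        have := (htail a (k + 1)).1
        rw [List.replicate_succ, List.cons_append] at this ⊢
        exact List.isChain_cons_cons.2 ⟨Or.inl rfl, this⟩
    clear hn hn' hα
    induction u with
    | nil => exact hstart
    | cons b u ih =>
      cases u with
      | nil => exact List.isChain_cons_cons.2 ⟨rfl, hstart⟩
      | cons c u => exact List.isChain_cons_cons.2 ⟨rfl, ih⟩
  · intro d hd
    rw [← List.cons_append, ← List.append_assoc, List.getLast?_append_cons] at hd
    simp only [List.getLast?_singleton, Option.mem_def, Option.some.injEq] at hd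
    rw [← hd]
    trivial
  · rw [List.filterMap_append, List.filterMap_cons_some (f := decode) (b := a) rfl, (htail a k).2,
      List.filterMap_map]
    congr 1
    exact List.filterMap_some

end StretchLetter

/-! ### The multiplication relations of an automatic structure -/

/-- The pairs of words of `L` related by right multiplication by `s`. -/
def mulRel {A S : Type*} [Semigroup S] (ψ : A → S) (L : Set (FreeSemigroup A)) (s : S) :
    Set (FreeSemigroup A × FreeSemigroup A) :=
  {p | p.1 ∈ L ∧ p.2 ∈ L ∧ FreeSemigroup.lift ψ p.1 * s = FreeSemigroup.lift ψ p.2}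

/-- The pairs of words of `L` representing the same element. -/
def eqRel {A S : Type*} [Semigroup S] (ψ : A → S) (L : Set (FreeSemigroup A)) :
    Set (FreeSemigroup A × FreeSemigroup A) :=
  {p | p.1 ∈ L ∧ p.2 ∈ L ∧ FreeSemigroup.lift ψ p.1 = FreeSemigroup.lift ψ p.2}

/-- Write `s` as a product of generators and compose their relations; the intermediate products have
representatives in `L` because `L` maps onto `S`. -/
theorem IsAutomaticStructure.syncRegular_mulRel {A : Type} {S : Type*} [Finite A] [Semigroup S]
    {ψ : A → S} {L : Set (FreeSemigroup A)} (h : IsAutomaticStructure ψ L) (s : S) :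
    SyncRegular (lettersRel (mulRel ψ L s)) := by
  obtain ⟨w, rfl⟩ := h.generates s
  induction w using FreeSemigroup.recOnMul with
  | ih1 a => exact isRegular_paddedLanguage_iff.1 (h.regular_mul a)
  | ih2 a w ih1 ih2 =>
    refine (ih1.comp ih2).congr fun u v => ?_
    rw [map_mul]
    constructor
    · rintro ⟨⟨α, β⟩, ⟨hα, hβ, h1⟩, rfl, rfl⟩
      obtain ⟨γ, hγ, h2⟩ := h.image_eq.ge
        (Set.mem_univ (FreeSemigroup.lift ψ α * FreeSemigroup.lift ψ (FreeSemigroup.of a)))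
      refine ⟨γ.letters, ⟨(α, γ), ⟨hα, hγ, h2.symm⟩, rfl, rfl⟩, (γ, β), ⟨hγ, hβ, ?_⟩, rfl, rfl⟩
      dsimp only at h1 ⊢
      rw [h2, mul_assoc, h1]
    · rintro ⟨_, ⟨⟨α, γ⟩, ⟨hα, hγ, h1⟩, rfl, rfl⟩, ⟨γ', β⟩, ⟨-, hβ, h2⟩, h3, rfl⟩
      obtain rfl := FreeSemigroup.letters_injective h3
      refine ⟨(α, β), ⟨hα, hβ, ?_⟩, rfl, rfl⟩
      dsimp only at h1 h2 ⊢
      rw [← mul_assoc, h1, h2]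

/-! ### The automatic structure of a wreath product with a finite semigroup -/

namespace WreathWords

variable {A τ : Type} {S T : Type*} [Semigroup S] [Semigroup T]

/-- Letters of words for the wreath product: a tuple of letters of stretched words and (a name of)
an element of `T`. -/
abbrev Letter (A τ : Type) : Type := (τ → StretchLetter A) × τ

/-- The element of the wreath product denoted by a letter. -/
def val (e : T ≃ τ) (ψ p q z : A → S) (c : Letter A τ) : UnrestrictedWreath S T :=
  ⟨fun x => (c.1 (e x)).val ψ p q z, e.symm c.2⟩

/-- The letter of the original word at the coordinate `i`. -/
def decode (i : τ) (c : Letter A τ) : Option A := (c.1 i).decode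

/-- The letters allowed to follow each other: the components in `T` of all letters but the last
one are right identities. -/
def Follows (e : T ≃ τ) (c c' : Letter A τ) : Prop :=
  (∀ x : T, x * e.symm c.2 = x) ∧ ∀ i, (c.1 i).Follows (c'.1 i)

/-- The words that are made of stretched words of `L` in each coordinate. -/
def words (e : T ≃ τ) (L : Set (FreeSemigroup A)) : Set (FreeSemigroup (Letter A τ)) :=
  {w | (w.letters.IsChain (Follows e) ∧ ∀ c ∈ w.letters.getLast?, ∀ i, (c.1 i).IsFinal) ∧
    ∀ i, w.letters.filterMap (decode i) ∈ wordLanguage L}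

/-- The words that represent an element with the given component in `T`. -/
def topLanguage (e : T ≃ τ) (L : Set (FreeSemigroup A)) (ψ p q z : A → S) (t : T) :
    Language (Letter A τ) :=
  {l | ∃ w ∈ words e L, w.letters = l ∧ (FreeSemigroup.lift (val e ψ p q z) w).top = t}

variable {e : T ≃ τ} {L : Set (FreeSemigroup A)} {ψ p q z : A → S}

theorem isChain_decode {l : List (Letter A τ)} (h : l.IsChain (Follows e)) (i : τ) :
    l.IsChain fun a b => decode i a = none → decode i b = none :=
  h.imp fun _ _ hab => (hab.2 i).decode_eq_none

theorem top_lift (w : FreeSemigroup (Letter A τ)) :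
    (FreeSemigroup.lift (val e ψ p q z) w).top = FreeSemigroup.lift (fun c => e.symm c.2) w := by
  induction w using FreeSemigroup.recOnMul with
  | ih1 c => rfl
  | ih2 c w ih1 ih2 => rw [map_mul, map_mul, UnrestrictedWreath.top_mul, ih1, ih2]

/-- All letters before the last have a right identity as `T`-component, so the coordinate `x` is
never shifted while the word is evaluated. -/
theorem base_lift (x : T) (c : Letter A τ) (l : List (Letter A τ))
    (h : (c :: l).IsChain (Follows e)) :
    (FreeSemigroup.lift (val e ψ p q z) ⟨c, l⟩).base x =
      FreeSemigroup.lift (StretchLetter.val ψ p q z) ⟨c.1 (e x), l.map fun c => c.1 (e x)⟩ := by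
  induction l generalizing c with
  | nil => rfl
  | cons d l ih =>
    rw [List.isChain_cons_cons] at h
    have h1 : FreeSemigroup.lift (val e ψ p q z) ⟨c, d :: l⟩ =
        val e ψ p q z c * FreeSemigroup.lift (val e ψ p q z) ⟨d, l⟩ :=
      FreeSemigroup.lift_of_mul (val e ψ p q z) c ⟨d, l⟩
    have hx : x * (val e ψ p q z c).top = x := h.1.1 x
    rw [h1, UnrestrictedWreath.base_mul, hx, ih d h.2]
    exact (FreeSemigroup.lift_of_mul (StretchLetter.val ψ p q z) (c.1 (e x))
      ⟨d.1 (e x), l.map fun c => c.1 (e x)⟩).symm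

theorem base_lift_eq (hp : ∀ a, ψ a = p a * z a) (hq : ∀ a, z a = q a * z a)
    {w : FreeSemigroup (Letter A τ)} (hw : w ∈ words e L) {x : T} {α : FreeSemigroup A}
    (hα : α.letters = w.letters.filterMap (decode (e x))) :
    (FreeSemigroup.lift (val e ψ p q z) w).base x = FreeSemigroup.lift ψ α := by
  obtain ⟨c, l⟩ := w
  obtain ⟨⟨hc, hlast⟩, -⟩ := hw
  have hmap : (c.1 (e x) :: l.map fun c => c.1 (e x)) = (c :: l).map fun c => c.1 (e x) := rfl
  have hfm : α.letters = (c.1 (e x) :: l.map fun c => c.1 (e x)).filterMap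
      StretchLetter.decode := by
    rw [hα, hmap, List.filterMap_map]
    rfl
  have hl := StretchLetter.lift_val hp hq (c.1 (e x)) (l.map fun c => c.1 (e x))
    (by
      rw [hmap, List.isChain_map]
      exact hc.imp fun _ _ h => h.2 (e x))
    (by
      rw [hmap, List.getLast?_map]
      intro d hd
      obtain ⟨c', hc', rfl⟩ := Option.map_eq_some_iff.1 hd
      exact hlast c' hc' _)
  rw [base_lift x c l hc]
  refine hl.2 ?_ α hfm
  -- A word starting inside the added tail would decode to the empty word, but `α` is nonempty.
  by_contra hd
  have : ∃ a, c.1 (e x) = .loop a ∨ c.1 (e x) = .final a := by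
    cases hcx : c.1 (e x) <;> simp [hcx, StretchLetter.decode] at hd ⊢
  obtain ⟨a, ha⟩ := this
  rw [(hl.1 a ha).2] at hfm
  cases hfm

theorem isRegular_topLanguage [Finite A] [Finite τ] (hL : (wordLanguage L).IsRegular) (t : T) :
    (topLanguage e L ψ p q z t).IsRegular := by
  have : Finite T := Finite.of_equiv τ e.symm
  refine (((Language.isRegular_isChain (Follows e) fun c => ∀ i, (c.1 i).IsFinal).and
    (Language.isRegular_forall fun i => hL.preimage_filterMap (decode i))).and
    (Language.isRegular_lift_eq (fun c : Letter A τ => e.symm c.2) t)).congr fun l => ?_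
  change (∃ w ∈ words e L, w.letters = l ∧
      (FreeSemigroup.lift (val e ψ p q z) w).top = t) ↔
    ((l.IsChain (Follows e) ∧ ∀ c ∈ l.getLast?, ∀ i, (c.1 i).IsFinal) ∧
      ∀ i, l.filterMap (decode i) ∈ wordLanguage L) ∧
    ∃ w : FreeSemigroup (Letter A τ), w.letters = l ∧
      FreeSemigroup.lift (fun c => e.symm c.2) w = t
  simp only [top_lift]
  constructor
  · rintro ⟨w, hw, rfl, ht⟩
    exact ⟨hw, w, rfl, ht⟩
  · rintro ⟨hw, w, rfl, ht⟩
    exact ⟨w, hw, rfl, ht⟩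

/-- The chain conditions needed to pull back each relation along `decode i` hold automatically for
words of the structure. -/
theorem syncRegular_coordinatewise [Finite A] [Finite τ] (hL : (wordLanguage L).IsRegular)
    {R : τ → List A → List A → Prop} (hR : ∀ i, SyncRegular (R i)) (t t' : T) :
    SyncRegular fun u v => u ∈ topLanguage e L ψ p q z t ∧ v ∈ topLanguage e L ψ p q z t' ∧
      ∀ i, R i (u.filterMap (decode i)) (v.filterMap (decode i)) := by
  have hreg : ∀ t : T, (topLanguage e L ψ p q z t).IsRegular := isRegular_topLanguage hL
  refine ((SyncRegular.left (hreg t)).and ((SyncRegular.right (hreg t')).and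
    (SyncRegular.iInter fun i => (hR i).preimage_filterMap (decode i)))).congr fun u v => ?_
  refine and_congr_right ?_
  rintro ⟨w, hw, rfl, -⟩
  refine and_congr_right ?_
  rintro ⟨w', hw', rfl, -⟩
  exact forall_congr' fun i =>
    ⟨fun h => ⟨isChain_decode hw.1.1 i, isChain_decode hw'.1.1 i, h⟩, fun h => h.2.2⟩

theorem syncRegular_mulRel [Finite A] [Finite τ] (h : IsAutomaticStructure ψ L)
    (hp : ∀ a, ψ a = p a * z a) (hq : ∀ a, z a = q a * z a) (g : UnrestrictedWreath S T) :
    SyncRegular (lettersRel (mulRel (val e ψ p q z) (words e L) g)) := by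
  have : Finite T := Finite.of_equiv τ e.symm
  -- Once the `T`-component `t` of the left word is fixed, multiplication by `g` multiplies
  -- coordinate `x` by the constant `g.base (x * t)`.
  refine (SyncRegular.iUnion fun t : T => syncRegular_coordinatewise (e := e) (ψ := ψ) (p := p)
    (q := q) (z := z) h.regular (fun i => h.syncRegular_mulRel (g.base (e.symm i * t))) t
      (t * g.top)).congr fun u v => ?_
  constructor
  · rintro ⟨⟨w, w'⟩, ⟨hw, hw', hmul⟩, rfl, rfl⟩
    dsimp only at hmul
    refine ⟨_, ⟨w, hw, rfl, rfl⟩, ⟨w', hw', rfl, ?_⟩, fun i => ?_⟩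
    · rw [← hmul, UnrestrictedWreath.top_mul]
    · obtain ⟨α, hα, hα'⟩ := hw.2 i
      obtain ⟨β, hβ, hβ'⟩ := hw'.2 i
      refine ⟨(α, β), ⟨hα, hβ, ?_⟩, hα', hβ'⟩
      dsimp only
      rw [← base_lift_eq hp hq hw (x := e.symm i) (by simpa using hα'),
        ← base_lift_eq hp hq hw' (x := e.symm i) (by simpa using hβ'), ← hmul,
        UnrestrictedWreath.base_mul]
  · rintro ⟨t, ⟨w, hw, rfl, rfl⟩, ⟨w', hw', rfl, htop⟩, hR⟩
    refine ⟨(w, w'), ⟨hw, hw', UnrestrictedWreath.ext (funext fun x => ?_) htop.symm⟩, rfl, rfl⟩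
    obtain ⟨⟨α, β⟩, ⟨-, -, hαβ⟩, hα, hβ⟩ := hR (e x)
    rw [UnrestrictedWreath.base_mul, base_lift_eq hp hq hw hα, base_lift_eq hp hq hw' hβ, ← hαβ,
      e.symm_apply_apply]

theorem syncRegular_eqRel [Finite A] [Finite τ] (h : IsAutomaticStructure ψ L)
    (hp : ∀ a, ψ a = p a * z a) (hq : ∀ a, z a = q a * z a) :
    SyncRegular (lettersRel (eqRel (val e ψ p q z) (words e L))) := by
  have : Finite T := Finite.of_equiv τ e.symm
  refine (SyncRegular.iUnion fun t : T => syncRegular_coordinatewise (e := e) (ψ := ψ) (p := p)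
    (q := q) (z := z) h.regular (fun _ => isRegular_paddedLanguage_iff.1 h.regular_eq) t t).congr
      fun u v => ?_
  constructor
  · rintro ⟨⟨w, w'⟩, ⟨hw, hw', heq⟩, rfl, rfl⟩
    dsimp only at heq
    refine ⟨_, ⟨w, hw, rfl, rfl⟩, ⟨w', hw', rfl, by rw [heq]⟩, fun i => ?_⟩
    obtain ⟨α, hα, hα'⟩ := hw.2 i
    obtain ⟨β, hβ, hβ'⟩ := hw'.2 i
    refine ⟨(α, β), ⟨hα, hβ, ?_⟩, hα', hβ'⟩
    dsimp only
    rw [← base_lift_eq hp hq hw (x := e.symm i) (by simpa using hα'),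
      ← base_lift_eq hp hq hw' (x := e.symm i) (by simpa using hβ'), heq]
  · rintro ⟨t, ⟨w, hw, rfl, rfl⟩, ⟨w', hw', rfl, htop⟩, hR⟩
    refine ⟨(w, w'), ⟨hw, hw', UnrestrictedWreath.ext (funext fun x => ?_) htop.symm⟩, rfl, rfl⟩
    obtain ⟨⟨α, β⟩, ⟨-, -, hαβ⟩, hα, hβ⟩ := hR (e x)
    rw [base_lift_eq hp hq hw hα, base_lift_eq hp hq hw' hβ, hαβ]

/-- Represent each coordinate by a word of `L`, stretch all of them to a common length, and spell
the `T`-component as `r ⋯ r u`. -/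
theorem exists_mem_words [Finite τ] (hL : FreeSemigroup.lift ψ '' L = Set.univ)
    (hT : ∀ t : T, ∃ r u : T, (∀ x, x * r = x) ∧ t = r * u)
    (hp : ∀ a, ψ a = p a * z a) (hq : ∀ a, z a = q a * z a) (g : UnrestrictedWreath S T) :
    ∃ w ∈ words e L, FreeSemigroup.lift (val e ψ p q z) w = g := by
  obtain ⟨r, u, hr, hru⟩ := hT g.top
  choose α hα hαg using fun i : τ => hL.ge (Set.mem_univ (g.base (e.symm i)))
  obtain ⟨n, hn⟩ : ∃ n, ∀ i, (α i).letters.length ≤ n := by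
    obtain ⟨n, hn⟩ := (Set.finite_range fun i => (α i).letters.length).bddAbove
    exact ⟨n, fun i => hn ⟨i, rfl⟩⟩
  -- With total length `n + 1 ≥ 2`, at least one `r` precedes `u`; a single letter would give only
  -- `u` instead of `r u`.
  have hn0 : 1 ≤ n := (by simp [FreeSemigroup.letters] :
    1 ≤ (α (e r)).letters.length).trans (hn _)
  choose v hlen hchain hlast hdec using fun i =>
    StretchLetter.exists_stretch (α i) (n + 1) (Nat.lt_succ_of_le (hn i))
  let c : Fin (n + 1) → Letter A τ := fun k =>
    (fun i => (v i)[k.1]'(by rw [hlen]; exact k.2), if k.1 < n then e r else e u)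
  let w : FreeSemigroup (Letter A τ) := ⟨c 0, List.ofFn fun k : Fin n => c k.succ⟩
  have hw : w.letters = List.ofFn c := (List.ofFn_succ (f := c)).symm
  have hcoord : ∀ i, w.letters.map (fun d => d.1 i) = v i := by
    intro i
    rw [hw, List.map_ofFn]
    refine List.ext_getElem (by simp [hlen]) fun k h1 h2 => ?_
    simp only [List.getElem_ofFn, Function.comp_apply, c]
  have hmem : w ∈ words e L := by
    refine ⟨⟨?_, ?_⟩, fun i => ⟨α i, hα i, ?_⟩⟩
    · rw [hw, List.isChain_iff_getElem]
      intro k hk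
      rw [List.length_ofFn] at hk
      simp only [List.getElem_ofFn]
      refine ⟨fun x => ?_, fun i => ?_⟩
      · have hk' : k < n := by omega
        simp [c, hk', hr]
      · exact List.isChain_iff_getElem.1 (hchain i) k (by rw [hlen]; exact hk)
    · intro d hd i
      refine hlast i _ ?_
      rw [← hcoord i, List.getLast?_map]
      exact Option.mem_map_of_mem _ hd
    · rw [← hdec i, ← hcoord i, List.filterMap_map]
      rfl
  refine ⟨w, hmem, UnrestrictedWreath.ext (funext fun x => ?_) ?_⟩
  · rw [base_lift_eq hp hq hmem (α := α (e x)), hαg, e.symm_apply_apply]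
    rw [← hdec, ← hcoord, List.filterMap_map]
    rfl
  · have key : ∀ (l : List (Letter A τ)) (t : T), (∀ d ∈ l, e.symm d.2 = r) →
        l.foldl (fun a d => a * e.symm d.2) t = t := by
      intro l
      induction l with
      | nil => intro t _; rfl
      | cons d l ih =>
        intro t hl
        rw [List.foldl_cons, hl d (by simp), hr]
        exact ih t fun d' hd' => hl d' (List.mem_cons_of_mem _ hd')
    obtain ⟨m, rfl⟩ := Nat.exists_eq_add_of_le' hn0
    rw [top_lift, FreeSemigroup.lift_mk_eq_foldl, List.ofFn_succ', List.concat_eq_append,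
      List.foldl_append, key (List.ofFn _) _ ?_, hru]
    · simp [c]
    · intro d hd
      obtain ⟨k, rfl⟩ := (List.mem_ofFn' _ _).1 hd
      simp [c]

theorem isAutomaticStructure [Finite A] [Finite τ] (h : IsAutomaticStructure ψ L)
    (hT : ∀ t : T, ∃ r u : T, (∀ x, x * r = x) ∧ t = r * u)
    (hp : ∀ a, ψ a = p a * z a) (hq : ∀ a, z a = q a * z a) :
    IsAutomaticStructure (val e ψ p q z) (words e L) where
  generates g := by
    obtain ⟨w, -, hw⟩ := exists_mem_words (e := e) h.image_eq hT hp hq g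
    exact ⟨w, hw⟩
  regular := by
    have : Finite T := Finite.of_equiv τ e.symm
    refine (Language.isRegular_exists fun t : T =>
      isRegular_topLanguage (e := e) (ψ := ψ) (p := p) (q := q) (z := z) h.regular t).congr
        fun l => ?_
    constructor
    · rintro ⟨w, hw, rfl⟩
      exact ⟨_, w, hw, rfl, rfl⟩
    · rintro ⟨_, w, hw, rfl, rfl⟩
      exact ⟨w, hw, rfl⟩
  image_eq := Set.eq_univ_of_forall fun g => exists_mem_words h.image_eq hT hp hq g
  regular_eq := isRegular_paddedLanguage_iff.2 (syncRegular_eqRel h hp hq)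
  regular_mul c := isRegular_paddedLanguage_iff.2 (syncRegular_mulRel h hp hq (val e ψ p q z c))

end WreathWords

/-! ### The main theorem -/

theorem UnrestrictedWreath.isAutomaticSemigroup {S T : Type*} [Semigroup S] [Semigroup T]
    [Finite T] (hS : IsAutomaticSemigroup S) (hdiag : ¬ (diagonalAct S).IsFinitelyGenerated)
    (hfg : IsFinitelyGeneratedSemigroup (UnrestrictedWreath S T)) :
    IsAutomaticSemigroup (UnrestrictedWreath S T) := by
  have hT : Nonempty T := by
    obtain ⟨B, ⟨b⟩, -, φ, -⟩ := hfg
    exact ⟨(φ b).top⟩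
  -- The argument for `S = S²` uses two distinct coordinates, so trivial `T` is treated separately.
  rcases subsingleton_or_nontrivial T with hT' | hT'
  · have : Unique T := ⟨⟨hT.some⟩, fun _ => Subsingleton.elim _ _⟩
    exact hS.of_mulEquiv UnrestrictedWreath.mulEquivOfUnique
  · have := infinite_of_diagonalAct hdiag
    have hsq := UnrestrictedWreath.eq_mul_of_isFinitelyGenerated hfg
    obtain ⟨A, hA, hA', ψ, L, h⟩ := hS
    choose p q z hp hq using fun a => exists_eq_mul_and_mul_eq h.generates hsq (ψ a)
    let e := Finite.equivFin T
    exact ⟨WreathWords.Letter A (Fin (Nat.card T)), ⟨fun _ => .plain hA.some, e hT.some⟩,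
      inferInstance, WreathWords.val e ψ p q z, WreathWords.words e L,
      WreathWords.isAutomaticStructure h
        (UnrestrictedWreath.exists_rightIdentity_mul hdiag hfg) hp hq⟩

theorem mainTheorem5 {S : Type*} {T : Type*} [Semigroup S] [Semigroup T]
    (e : WithOne S) (he : IsIdempotentElem e)
    (hT : Finite T)
    (hS : IsAutomaticSemigroup S)
    (hdiag : ¬ (diagonalAct S).IsFinitelyGenerated)
    (hfg : IsFinitelyGeneratedSemigroup (wreathProduct S T e)) :
    IsAutomaticSemigroup (wreathProduct S T e) := by
  rw [wreathProduct_eq_top] at hfg ⊢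
  have f : (⊤ : Subsemigroup (UnrestrictedWreath S T)) ≃* UnrestrictedWreath S T :=
    Subsemigroup.topEquiv
  exact (UnrestrictedWreath.isAutomaticSemigroup hS hdiag (hfg.of_mulEquiv f)).of_mulEquiv f.symm
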